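/- A topological dynamical system $(G,X)$ is a Hausdorff topological group $G$ acting continuously on a compact Hausdorff space $X$; it is minimal if every orbit $Gx$ is dense in $X$. For $d\ge 0$, let $\mathcal{HK}^{[d]}$ be the subgroup of $G^{\{0,1\}^d}$ generated by the elements $[g]_F$, where $g\in G$ and $F=\{\omega\in\{0,1\}^d:\omega_i=a\}$ ($1\le i\le d$, $a\in\{0,1\}$) is a hyperface of the cube, and $[g]_F(\omega)=g$ if $\omega\in F$ and $[g]_F(\omega)=\mathrm{Id}$ otherwise. It acts coordinatewise on $X^{\{0,1\}^d}$. Let $x^{[d]}$ denote the constant configuration with value $x$, and put $$C_G^{[d]}(X)=\overline{\{\gamma x^{[d]}:\gamma\in\mathcal{HK}^{[d]},\ x\in X\}}\subseteq X^{\{0,1\}^d}.$$ For $d\ge 1$, the nilpotent regionally proximal relation of order $d$, $\mathrm{NRP}^{[d]}(X)\subseteq X\times X$, is the set of pairs $(x,y)$ such that the configuration $\{0,1\}^{d+1}\to X$ with value $y$ at $(1,\dots,1)$ and value $x$ at every other vertex belongs to $C_G^{[d+1]}(X)$. Theorem. Let $(G,X)$ be a minimal topological dynamical system, let $(G,Y)$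 be a topological dynamical system with the same group $G$, and let $\pi:X\to Y$ be a factor map, i.e. a continuous, $G$-equivariant, surjective map. Then for every $d\ge 1$, $$(\pi\times\pi)\bigl(\mathrm{NRP}^{[d]}(X)\bigr)=\mathrm{NRP}^{[d]}(Y).$$ -/

import Mathlib

namespace NilRP

/-- The vertex set `{0,1}^d` of the discrete cube, with `false` for `0` and `true` for `1`. -/
abbrev Cube (d : ℕ) : Type := Fin d → Bool

/-- The hyperface `{ω | ω i = a}` of the discrete cube. -/
def hyperface {d : ℕ} (i : Fin d) (a : Bool) : Set (Cube d) := {ω | ω i = a}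

/-- The element `[g]_F` of `G^[d]`: it is `g` at the vertices in `F` and the identity elsewhere. -/
noncomputable def faceElement {G : Type*} [Group G] {d : ℕ} (g : G) (F : Set (Cube d)) :
    Cube d → G :=
  Set.mulIndicator F (fun _ => g)

/-- The Host–Kra cube group `HK^[d]`: the subgroup of `G^[d]` generated by the elements `[g]_F`,
for `g` in `G` and `F` a hyperface. -/
def hostKra (G : Type*) [Group G] (d : ℕ) : Subgroup (Cube d → G) :=
  Subgroup.closure {γ | ∃ (i : Fin d) (a : Bool) (g : G), γ = faceElement g (hyperface i a)}

/-- The dynamical cubes `C_G^[d](X)`: the closure in `X^[d]` (product topology) of the set of all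
`γ x^[d]`, where `γ` is in `HK^[d]`, `x^[d]` is a constant configuration, and `γ` acts
coordinatewise. -/
def dynCubes (G X : Type*) [Group G] [TopologicalSpace X] [MulAction G X] (d : ℕ) :
    Set (Cube d → X) :=
  closure {c | ∃ γ ∈ hostKra G d, ∃ x : X, c = fun ω => γ ω • x}

/-- The lower corner: the configuration with value `y` at the vertex `(1,…,1)` and value `x` at
all other vertices. -/
def lowerCorner {X : Type*} (d : ℕ) (x y : X) : Cube d → X :=
  fun ω => if ω = (fun _ => true) then y else x

/-- The nilpotent regionally proximal relation of order `d`, as a subset of `X × X`. -/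
def NRP (G X : Type*) [Group G] [TopologicalSpace X] [MulAction G X] (d : ℕ) : Set (X × X) :=
  {p | lowerCorner (d + 1) p.1 p.2 ∈ dynCubes G X (d + 1)}

end NilRP

/-! One inclusion is functoriality of dynamical cubes. Conversely, compactness lifts a lower corner
of `Y` to a cube `c` of `X`, whose vertices off the top `(1,…,1)` only share a fibre of `π`;
`exists_lowerCorner_mem_dynCubes` makes them equal.

By minimality `c = r x₀`, with `x₀ = c(0,…,0)` and `r` in the enveloping semigroup of the Host–Kra
group. Replacing `r` by `u r u`, for a minimal idempotent `u` fixing `x₀`, places it in a group with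
identity `u` (`exists_inverse`). Right multiplication by the inverse of the pullback of `r` to a
face `ω i = 0` turns `r` into `u` on that face. Fibres are kept, because the face misses the top and
enveloping semigroup elements respect fibres. After all faces, `r = u` off the top. A second minimal
idempotent, fixing `c(1,…,1)`, then brings the top back to its fibre. -/

namespace NilRP

/-! ### Self-maps under pointwise convergence -/

section Ellis

open MulAction Set

/-- The topology of pointwise convergence on self-maps. -/
instance endTopology (X : Type*) [TopologicalSpace X] : TopologicalSpace (Function.End X) :=
  inferInstanceAs (TopologicalSpace (X → X))

instance endT2Space (X : Type*) [TopologicalSpace X] [T2Space X] : T2Space (Function.End X) :=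
  inferInstanceAs (T2Space (X → X))

instance endCompactSpace (X : Type*) [TopologicalSpace X] [CompactSpace X] :
    CompactSpace (Function.End X) :=
  inferInstanceAs (CompactSpace (X → X))

theorem continuous_end_apply {X : Type*} [TopologicalSpace X] (x : X) :
    Continuous fun p : Function.End X => p x :=
  continuous_apply (A := fun _ : X => X) x

theorem continuous_end_mul_right {X : Type*} [TopologicalSpace X] (r : Function.End X) :
    Continuous fun p : Function.End X => p * r :=
  continuous_pi (A := fun _ : X => X) fun x => continuous_end_apply (r x)

theorem continuous_end_mul_left {X : Type*} [TopologicalSpace X] {r : Function.End X}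
    (hr : Continuous r) : Continuous fun p : Function.End X => r * p :=
  continuous_pi (A := fun _ : X => X) fun x => hr.comp (continuous_end_apply x)

theorem continuous_pi_mul_right {ι X : Type*} [TopologicalSpace X] (r : ι → Function.End X) :
    Continuous fun p : ι → Function.End X => p * r :=
  continuous_pi fun i => (continuous_end_mul_right (r i)).comp (continuous_apply i)

/-- In a right topological semigroup, the closure of a multiplicatively closed set whose elements
act continuously from the left is multiplicatively closed. -/
theorem mul_mem_closure_of_continuous {M : Type*} [Mul M] [TopologicalSpace M] {S : Set M}
    (hright : ∀ r : M, Continuous fun p => p * r)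
    (hleft : ∀ s ∈ S, Continuous fun p => s * p) (hS : ∀ a ∈ S, ∀ b ∈ S, a * b ∈ S)
    {p q : M} (hp : p ∈ closure S) (hq : q ∈ closure S) : p * q ∈ closure S := by
  have h : ∀ s ∈ S, s * q ∈ closure S := fun s hs =>
    map_mem_closure (hleft s hs) hq fun b hb => hS s hs b hb
  have := map_mem_closure (hright q) hp h
  rwa [closure_closure] at this

/-! ### Enveloping semigroups and Host–Kra cubes -/

variable (G X : Type*) [Group G] [TopologicalSpace X] [MulAction G X]

/-- The enveloping semigroup of the action of `G` on `X`. -/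
def ellis : Set (Function.End X) := closure (range (toEndHom : G →* Function.End X))

/-- The enveloping semigroup of the coordinatewise action of the Host–Kra group. -/
def cubeEllis (d : ℕ) : Set (Cube d → Function.End X) :=
  closure ((fun (γ : Cube d → G) ω => (toEndHom (γ ω) : Function.End X)) '' hostKra G d)

variable {G X}

theorem toEndHom_mem_ellis (g : G) : (toEndHom g : Function.End X) ∈ ellis G X :=
  subset_closure ⟨g, rfl⟩

theorem one_mem_cubeEllis {d : ℕ} : (1 : Cube d → Function.End X) ∈ cubeEllis G X d :=
  subset_closure ⟨1, one_mem _, by funext ω; simp⟩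

theorem apply_mem_ellis {d : ℕ} {p : Cube d → Function.End X} (hp : p ∈ cubeEllis G X d)
    (ω : Cube d) : p ω ∈ ellis G X :=
  map_mem_closure (f := fun p : Cube d → Function.End X => p ω) (continuous_apply ω) hp
    (by rintro _ ⟨γ, -, rfl⟩; exact ⟨γ ω, rfl⟩)

theorem comp_eq_of_mem_ellis {Y : Type*} [TopologicalSpace Y] [T2Space Y] [MulAction G Y]
    {π : X → Y} (hπ : Continuous π) (hG : ∀ (g : G) (x : X), π (g • x) = g • π x)
    {p : Function.End X} (hp : p ∈ ellis G X) {x x' : X} (h : π x = π x') :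
    π (p x) = π (p x') := by
  have hc : IsClosed {p : Function.End X | π (p x) = π (p x')} :=
    isClosed_eq (hπ.comp (continuous_end_apply x)) (hπ.comp (continuous_end_apply x'))
  refine closure_minimal ?_ hc hp
  rintro _ ⟨g, rfl⟩
  change π (g • x) = π (g • x')
  rw [hG, hG, h]

/-- Checked on generators: those in direction `j ≠ i` are unchanged, and those in direction `i`
become constant or trivial. -/
theorem pullback_mem_hostKra {d : ℕ} (i : Fin d) {γ : Cube d → G} (hγ : γ ∈ hostKra G d) :
    (fun ω => γ (Function.update ω i false)) ∈ hostKra G d := by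
  have hgen : ∀ (j : Fin d) (a : Bool) (g : G), faceElement g (hyperface j a) ∈ hostKra G d :=
    fun j a g => Subgroup.subset_closure ⟨j, a, g, rfl⟩
  induction hγ using Subgroup.closure_induction with
  | mem γ h =>
    obtain ⟨j, a, g, rfl⟩ := h
    by_cases hj : j = i
    · subst hj
      cases a
      · convert mul_mem (hgen j false g) (hgen j true g) using 1
        funext ω
        cases h : ω j <;> simp [faceElement, hyperface, mulIndicator, h]
      · convert one_mem (hostKra G d) using 1
        funext ω
        simp [faceElement, hyperface, mulIndicator]
    · convert hgen j a g using 1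
      funext ω
      by_cases h : ω j = a <;>
        simp [faceElement, hyperface, mulIndicator, Function.update_of_ne hj, h]
  | one => exact one_mem _
  | mul a b _ _ ha hb => exact mul_mem ha hb
  | inv a _ ha => exact inv_mem ha

theorem pullback_mem_cubeEllis {d : ℕ} (i : Fin d) {p : Cube d → Function.End X}
    (hp : p ∈ cubeEllis G X d) : (fun ω => p (Function.update ω i false)) ∈ cubeEllis G X d := by
  refine map_mem_closure (f := fun (p : Cube d → Function.End X) ω => p (Function.update ω i false))
    (continuous_pi fun ω => continuous_apply _) hp ?_
  rintro _ ⟨γ, hγ, rfl⟩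
  exact ⟨_, pullback_mem_hostKra i hγ, rfl⟩

theorem face_mem_cubeEllis {d : ℕ} (i : Fin d) (a : Bool) {p : Function.End X}
    (hp : p ∈ ellis G X) : (fun ω : Cube d => if ω i = a then p else 1) ∈ cubeEllis G X d := by
  refine map_mem_closure (f := fun (p : Function.End X) (ω : Cube d) => if ω i = a then p else 1)
    (continuous_pi fun ω => ?_) hp ?_
  · by_cases h : ω i = a
    · simpa [h] using continuous_id'
    · simpa [h] using continuous_const
  · rintro _ ⟨g, rfl⟩
    refine ⟨_, Subgroup.subset_closure ⟨i, a, g, rfl⟩, ?_⟩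
    funext ω
    by_cases h : ω i = a <;> simp [faceElement, hyperface, mulIndicator, h]

theorem const_mem_hostKra {d : ℕ} (g : G) : (fun _ => g) ∈ hostKra G (d + 1) := by
  have hgen : ∀ a : Bool, faceElement g (hyperface 0 a) ∈ hostKra G (d + 1) :=
    fun a => Subgroup.subset_closure ⟨0, a, g, rfl⟩
  convert mul_mem (hgen false) (hgen true) using 1
  funext ω
  cases h : ω 0 <;> simp [faceElement, hyperface, mulIndicator, h]

theorem const_mem_cubeEllis {d : ℕ} {p : Function.End X} (hp : p ∈ ellis G X) :
    (fun _ => p) ∈ cubeEllis G X (d + 1) := by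
  refine map_mem_closure (f := fun (p : Function.End X) (_ : Cube (d + 1)) => p)
    (continuous_pi fun ω => continuous_id) hp ?_
  rintro _ ⟨g, rfl⟩
  exact ⟨_, const_mem_hostKra g, rfl⟩

theorem smul_mem_dynCubes [ContinuousConstSMul G X] {d : ℕ} {γ : Cube d → G}
    (hγ : γ ∈ hostKra G d) {c : Cube d → X} (hc : c ∈ dynCubes G X d) :
    (fun ω => γ ω • c ω) ∈ dynCubes G X d := by
  refine map_mem_closure (f := fun (c : Cube d → X) ω => γ ω • c ω)
    (continuous_pi fun ω => (continuous_apply ω).const_smul _) hc ?_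
  rintro _ ⟨δ, hδ, x, rfl⟩
  exact ⟨_, mul_mem hγ hδ, x, by funext ω; simp [mul_smul]⟩

theorem apply_mem_dynCubes [ContinuousConstSMul G X] {d : ℕ} {p : Cube d → Function.End X}
    (hp : p ∈ cubeEllis G X d) {c : Cube d → X} (hc : c ∈ dynCubes G X d) :
    (fun ω => p ω (c ω)) ∈ dynCubes G X d := by
  have := map_mem_closure (f := fun (p : Cube d → Function.End X) ω => p ω (c ω))
    (t := dynCubes G X d)
    (continuous_pi fun ω => (continuous_end_apply (c ω)).comp (continuous_apply ω)) hp ?_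
  · rwa [dynCubes, closure_closure] at this
  · rintro _ ⟨γ, hγ, rfl⟩
    exact smul_mem_dynCubes hγ hc

theorem const_mem_dynCubes {d : ℕ} (x : X) : (fun _ => x) ∈ dynCubes G X d :=
  subset_closure ⟨1, one_mem _, x, by simp⟩

theorem mul_mem_ellis [ContinuousConstSMul G X] {p q : Function.End X}
    (hp : p ∈ ellis G X) (hq : q ∈ ellis G X) : p * q ∈ ellis G X := by
  refine mul_mem_closure_of_continuous continuous_end_mul_right ?_ ?_ hp hq
  · rintro _ ⟨g, rfl⟩
    exact continuous_end_mul_left (continuous_const_smul g)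
  · rintro _ ⟨g, rfl⟩ _ ⟨h, rfl⟩
    exact ⟨g * h, map_mul _ _ _⟩

theorem mul_mem_cubeEllis [ContinuousConstSMul G X] {d : ℕ} {p q : Cube d → Function.End X}
    (hp : p ∈ cubeEllis G X d) (hq : q ∈ cubeEllis G X d) : p * q ∈ cubeEllis G X d := by
  refine mul_mem_closure_of_continuous continuous_pi_mul_right ?_ ?_ hp hq
  · rintro _ ⟨γ, -, rfl⟩
    exact continuous_pi fun ω =>
      (continuous_end_mul_left (continuous_const_smul (γ ω))).comp (continuous_apply ω)
  · rintro _ ⟨γ, hγ, rfl⟩ _ ⟨δ, hδ, rfl⟩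
    exact ⟨γ * δ, mul_mem hγ hδ, by funext ω; simp⟩

/-- The element which is `u` off the vertex `(1,…,1)` and the identity there. -/
theorem offTop_mem_cubeEllis [ContinuousConstSMul G X] {d : ℕ} {u : Function.End X}
    (hu : u ∈ ellis G X) (huu : u * u = u) :
    (fun ω : Cube d => if ω = fun _ => true then 1 else u) ∈ cubeEllis G X d := by
  classical
  -- Multiply the face elements of `u` over `i ∈ S`; idempotence absorbs overlaps.
  have key : ∀ S : Finset (Fin d),
      (fun ω : Cube d => if ∃ i ∈ S, ω i = false then u else 1) ∈ cubeEllis G X d := by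
    intro S
    induction S using Finset.induction_on with
    | empty => simpa using! one_mem_cubeEllis
    | insert i S _ ih =>
      convert mul_mem_cubeEllis (face_mem_cubeEllis i false hu) ih using 1
      funext ω
      by_cases h1 : ω i = false <;> by_cases h2 : ∃ j ∈ S, ω j = false <;> simp [h1, h2, huu]
  convert key Finset.univ using 1
  funext ω
  by_cases h : ω = fun _ => true
  · simp [h]
  · have : ∃ i, ω i = false := by
      by_contra! h'
      exact h (funext fun i => by simpa using h' i)
    simp [h, this]

/-- The image of the compact semigroup at `x₀` is closed and contains every `γ g x₀`, as the
diagonal lies in the Host–Kra group; density of `G x₀` gives all `γ x`. -/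
theorem exists_cubeEllis_apply_eq [CompactSpace X] [T2Space X] [IsMinimal G X]
    [ContinuousConstSMul G X] {d : ℕ} (x₀ : X) {c : Cube (d + 1) → X}
    (hc : c ∈ dynCubes G X (d + 1)) : ∃ r ∈ cubeEllis G X (d + 1), ∀ ω, r ω x₀ = c ω := by
  let f : (Cube (d + 1) → Function.End X) → Cube (d + 1) → X := fun r ω => r ω x₀
  have hf : Continuous f :=
    continuous_pi fun ω => (continuous_end_apply x₀).comp (continuous_apply ω)
  have hcl : IsClosed (f '' cubeEllis G X (d + 1)) :=
    (isClosed_closure.isCompact.image hf).isClosed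
  have hmem : c ∈ f '' cubeEllis G X (d + 1) := by
    refine closure_minimal ?_ hcl hc
    rintro _ ⟨γ, hγ, x, rfl⟩
    have hγc : Continuous fun (x : X) (ω : Cube (d + 1)) => γ ω • x :=
      continuous_pi fun ω => continuous_const_smul _
    refine closure_minimal ?_ (hcl.preimage hγc) (dense_orbit G x₀ x)
    rintro _ ⟨g, rfl⟩
    exact ⟨_, subset_closure ⟨_, mul_mem hγ (const_mem_hostKra g), rfl⟩,
      funext fun ω => mul_smul (γ ω) g x₀⟩
  obtain ⟨r, hr, rfl⟩ := hmem
  exact ⟨r, hr, fun _ => rfl⟩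

/-! ### Minimal idempotents and their groups -/

/-- A minimal left ideal of the enveloping semigroup: all its idempotents are right identities,
and for a minimal action each point is fixed by one of them. -/
theorem exists_minimal_left_ideal [CompactSpace X] [T2Space X] [IsMinimal G X]
    [ContinuousConstSMul G X] : ∃ L ⊆ ellis G X,
      (∀ p ∈ ellis G X, ∀ q ∈ L, p * q ∈ L) ∧
      (∀ e ∈ L, e * e = e → ∀ p ∈ L, p * e = p) ∧
      ∀ x : X, ∃ u ∈ L, u * u = u ∧ u x = x := by
  let I : Set (Set (Function.End X)) :=
    {K | IsClosed K ∧ K.Nonempty ∧ K ⊆ ellis G X ∧ ∀ p ∈ ellis G X, ∀ q ∈ K, p * q ∈ K}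
  obtain ⟨L, hL⟩ : ∃ L, Minimal (· ∈ I) L := by
    refine zorn_superset I fun C hC hchain => ?_
    rcases C.eq_empty_or_nonempty with rfl | hne
    · exact ⟨ellis G X, ⟨isClosed_closure, ⟨_, toEndHom_mem_ellis 1⟩, subset_rfl,
        fun p hp q hq => mul_mem_ellis hp hq⟩, by simp⟩
    · refine ⟨⋂₀ C, ⟨isClosed_sInter fun K hK => (hC hK).1, ?_, ?_, ?_⟩,
        fun K hK => sInter_subset_of_mem hK⟩
      · have : Nonempty C := hne.to_subtype
        rw [sInter_eq_iInter]
        refine IsCompact.nonempty_iInter_of_directed_nonempty_isCompact_isClosed _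
          ?_ (fun K => (hC K.2).2.1) (fun K => (hC K.2).1.isCompact) (fun K => (hC K.2).1)
        exact fun A B => (hchain.total A.2 B.2).elim
          (fun h => ⟨A, subset_rfl, h⟩) fun h => ⟨B, h, subset_rfl⟩
      · obtain ⟨K, hK⟩ := hne
        exact (sInter_subset_of_mem hK).trans (hC hK).2.2.1
      · intro p hp q hq K hK
        exact (hC hK).2.2.2 p hp q (hq K hK)
  obtain ⟨hLc, hLne, hLE, hLI⟩ := hL.prop
  refine ⟨L, hLE, hLI, fun e he hee p hp => ?_, fun x => ?_⟩
  -- `L e` is a closed left ideal inside `L`, so it equals `L` and `p = q e`.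
  · have hI : (fun q => q * e) '' L ∈ I := by
      refine ⟨(hLc.isCompact.image (continuous_end_mul_right e)).isClosed, hLne.image _, ?_, ?_⟩
      · rintro _ ⟨q, hq, rfl⟩
        exact mul_mem_ellis (hLE hq) (hLE he)
      · rintro p hp _ ⟨q, hq, rfl⟩
        exact ⟨p * q, hLI p hp q hq, mul_assoc _ _ _⟩
    have hle : (fun q => q * e) '' L ⊆ L := by
      rintro _ ⟨q, hq, rfl⟩
      exact hLI q (hLE hq) e he
    obtain ⟨q, -, rfl⟩ := hL.le_of_le hI hle hp
    change q * e * e = q * e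
    rw [mul_assoc, hee]
  -- `L x` is closed and contains a dense orbit, so the elements of `L` fixing `x` form a nonempty
  -- compact semigroup.
  · have hclosed : IsClosed ((fun p : Function.End X => p x) '' L) :=
      (hLc.isCompact.image (continuous_end_apply x)).isClosed
    obtain ⟨p₀, hp₀⟩ := hLne
    have hx : x ∈ (fun p : Function.End X => p x) '' L := by
      refine closure_minimal ?_ hclosed (dense_orbit G (p₀ x) x)
      rintro _ ⟨g, rfl⟩
      exact ⟨_, hLI _ (toEndHom_mem_ellis g) p₀ hp₀, rfl⟩
    obtain ⟨p₁, hp₁, hp₁x⟩ := hx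
    obtain ⟨u, ⟨huL, hux⟩, huu⟩ := exists_idempotent_in_compact_subsemigroup
      continuous_end_mul_right (L ∩ {p : Function.End X | p x = x}) ⟨p₁, hp₁, hp₁x⟩
      (hLc.inter (isClosed_eq (continuous_end_apply x) continuous_const)).isCompact
      (fun p hp q hq => ⟨hLI p (hLE hp.1) q hq.1, by
        change p (q x) = x
        rw [hq.2, hp.2]⟩)
    exact ⟨u, huL, huu, hux⟩

/-- The elements of the cube enveloping semigroup lying coordinatewise in `u * ellis * u`, for a
minimal idempotent `u`, are invertible there. -/
theorem exists_inverse [CompactSpace X] [T2Space X] [ContinuousConstSMul G X]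
    {L : Set (Function.End X)} (hLE : L ⊆ ellis G X)
    (hLI : ∀ p ∈ ellis G X, ∀ q ∈ L, p * q ∈ L)
    (hLid : ∀ e ∈ L, e * e = e → ∀ p ∈ L, p * e = p)
    {u : Function.End X} (hu : u ∈ L) (huu : u * u = u) {d : ℕ}
    {r : Cube (d + 1) → Function.End X} (hr : r ∈ cubeEllis G X (d + 1))
    (hru : ∀ ω, r ω * u = r ω) (hur : ∀ ω, u * r ω = r ω) :
    ∃ q ∈ cubeEllis G X (d + 1), (∀ ω, q ω * u = q ω) ∧ (∀ ω, u * q ω = q ω) ∧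
      (∀ ω, q ω * r ω = u) ∧ ∀ ω, r ω * q ω = u := by
  have left : ∀ r ∈ cubeEllis G X (d + 1), (∀ ω, r ω * u = r ω) → (∀ ω, u * r ω = r ω) →
      ∃ q ∈ cubeEllis G X (d + 1), (∀ ω, q ω * u = q ω) ∧ (∀ ω, u * q ω = q ω) ∧
        ∀ ω, q ω * r ω = u := by
    intro r hr hru hur
    obtain ⟨e, ⟨q, hq, rfl⟩, hee⟩ := exists_idempotent_in_compact_subsemigroup
      continuous_pi_mul_right ((fun q => q * r) '' cubeEllis G X (d + 1))
      ⟨_, 1, one_mem_cubeEllis, rfl⟩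
      (isClosed_closure.isCompact.image (continuous_pi_mul_right r))
      (by
        rintro _ ⟨p, hp, rfl⟩ _ ⟨q, hq, rfl⟩
        exact ⟨p * r * q, mul_mem_cubeEllis (mul_mem_cubeEllis hp hr) hq, mul_assoc _ _ _⟩)
    have hU : (fun _ => u) ∈ cubeEllis G X (d + 1) := const_mem_cubeEllis (hLE hu)
    refine ⟨(fun _ => u) * q * (fun _ => u), mul_mem_cubeEllis (mul_mem_cubeEllis hU hq) hU,
      fun ω => ?_, fun ω => ?_, fun ω => ?_⟩
    · simp [mul_assoc, huu]
    · simp [← mul_assoc, huu]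
    · have hmem : q ω * r ω ∈ L := by
        rw [← hru ω, ← mul_assoc]
        exact hLI _ (mul_mem_ellis (apply_mem_ellis hq ω) (apply_mem_ellis hr ω)) u hu
      have := hLid _ hmem (congrFun hee ω) u hu
      simp only [Pi.mul_apply, mul_assoc, hur]
      exact this
  -- The left inverse `s` of the left inverse `q` must be `r`.
  obtain ⟨q, hq, hqu, huq, hqr⟩ := left r hr hru hur
  obtain ⟨s, -, hsu, -, hsq⟩ := left q hq hqu huq
  refine ⟨q, hq, hqu, huq, hqr, fun ω => ?_⟩
  have : s ω = r ω := by
    rw [← hsu ω, ← hqr ω, ← mul_assoc, hsq, hur]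
  rw [← this, hsq]

/-! ### Straightening cubes within fibres -/

/-- A dynamical cube whose vertices other than `(1,…,1)` lie in one fibre of `π` can be replaced
by a lower corner in the same fibres. -/
theorem exists_lowerCorner_mem_dynCubes [CompactSpace X] [T2Space X] [IsMinimal G X]
    [ContinuousConstSMul G X] {Y : Type*} [TopologicalSpace Y] [T2Space Y] [MulAction G Y]
    {π : X → Y} (hπ : Continuous π) (hG : ∀ (g : G) (x : X), π (g • x) = g • π x)
    {d : ℕ} {y z : Y} {c : Cube (d + 1) → X} (hc : c ∈ dynCubes G X (d + 1))
    (hcπ : ∀ ω, π (c ω) = lowerCorner (d + 1) y z ω) :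
    ∃ x x' : X, lowerCorner (d + 1) x x' ∈ dynCubes G X (d + 1) ∧ π x = y ∧ π x' = z := by
  classical
  obtain ⟨L, hLE, hLI, hLid, hLfix⟩ := exists_minimal_left_ideal (G := G) (X := X)
  have hpres : ∀ p ∈ ellis G X, ∀ {x x' : X}, π x = π x' → π (p x) = π (p x') :=
    fun p hp _ _ h => comp_eq_of_mem_ellis hπ hG hp h
  let top : Cube (d + 1) := fun _ => true
  let x₀ := c fun _ => false
  have hbot : (fun _ => false : Cube (d + 1)) ≠ fun _ => true :=
    fun h => Bool.false_ne_true (congrFun h 0)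
  have hx₀ : π x₀ = y := by simpa [lowerCorner, hbot] using hcπ fun _ => false
  have htop : π (c top) = z := by simpa [lowerCorner, top] using hcπ top
  obtain ⟨u, hu, huu, hux⟩ := hLfix x₀
  obtain ⟨w, hw, hww, hwx⟩ := hLfix (c top)
  have hux' : u x₀ = x₀ := hux
  have hU : (fun _ => u) ∈ cubeEllis G X (d + 1) := const_mem_cubeEllis (hLE hu)
  -- `S` records the faces `ω i = 0` on which `r` is already `u`.
  have normal : ∀ S : Finset (Fin (d + 1)), ∃ r ∈ cubeEllis G X (d + 1),
      (∀ ω, r ω * u = r ω) ∧ (∀ ω, u * r ω = r ω) ∧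
      (∀ ω, ω ≠ top → π (r ω x₀) = π x₀) ∧ π (r top x₀) = π (u (c top)) ∧
      ∀ ω, (∃ i ∈ S, ω i = false) → r ω = u := by
    intro S
    induction S using Finset.induction_on with
    | empty =>
      obtain ⟨r, hr, hrc⟩ := exists_cubeEllis_apply_eq x₀ hc
      have happ : ∀ ω, (u * r ω * u) x₀ = u (c ω) := fun ω => by
        change u (r ω (u x₀)) = _
        rw [hux', hrc]
      refine ⟨(fun _ => u) * r * (fun _ => u), mul_mem_cubeEllis (mul_mem_cubeEllis hU hr) hU,
        fun ω => by simp [mul_assoc, huu], fun ω => by simp [← mul_assoc, huu],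
        fun ω hω => ?_, congrArg π (happ top), by simp⟩
      refine (congrArg π (happ ω)).trans ?_
      conv_rhs => rw [← hux']
      refine hpres u (hLE hu) ?_
      rw [hcπ, hx₀, lowerCorner, if_neg hω]
    | insert i S _ ih =>
      obtain ⟨r, hr, hru, hur, hrx, hrt, hrS⟩ := ih
      obtain ⟨q, hq, hqu, huq, hqs, hsq⟩ := exists_inverse hLE hLI hLid hu huu
        (pullback_mem_cubeEllis i hr) (fun ω => hru _) (fun ω => hur _)
      have hupd : ∀ ω : Cube (d + 1), Function.update ω i false ≠ top := fun ω h => by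
        have := congrFun h i
        simp [top] at this
      have hqx : ∀ ω, π (q ω x₀) = π x₀ := fun ω => by
        have h1 := hpres (q ω) (apply_mem_ellis hq ω) (hrx _ (hupd ω))
        have h2 : q ω (r (Function.update ω i false) x₀) = x₀ :=
          (congrFun (hqs ω) x₀).trans hux'
        rw [h2] at h1
        exact h1.symm
      have hrq : ∀ ω, π ((r * q) ω x₀) = π (r ω x₀) := fun ω =>
        hpres (r ω) (apply_mem_ellis hr ω) (hqx ω)
      refine ⟨r * q, mul_mem_cubeEllis hr hq, fun ω => ?_, fun ω => ?_,
        fun ω hω => (hrq ω).trans (hrx ω hω), (hrq top).trans hrt, ?_⟩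
      · rw [Pi.mul_apply, mul_assoc, hqu]
      · rw [Pi.mul_apply, ← mul_assoc, hur]
      · rintro ω ⟨j, hj, hjω⟩
        by_cases hi : ω i = false
        · have : Function.update ω i false = ω := by
            rw [← hi, Function.update_eq_self]
          have h := hsq ω
          rw [this] at h
          exact h
        -- Faces already treated survive: the pullback of `r` is `u` there, hence so is its inverse
        -- `q`.
        · have hji : j ≠ i := fun h => hi (h ▸ hjω)
          have hjS : j ∈ S := (Finset.mem_insert.1 hj).resolve_left hji
          have h1 : r ω = u := hrS ω ⟨j, hjS, hjω⟩
          have h2 : r (Function.update ω i false) = u :=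
            hrS _ ⟨j, hjS, by rw [Function.update_of_ne hji, hjω]⟩
          have h := hsq ω
          rw [h2, huq] at h
          rw [Pi.mul_apply, h1, h, huu]
  obtain ⟨r, hr, -, -, -, hrt, hru⟩ := normal Finset.univ
  -- Since `w u = w`, applying `w` moves the top into the fibre of `w (c top) = c top`; off the top,
  -- `u w = u` restores `x₀`.
  have hmem : (fun ω => (if ω = (fun _ => true) then 1 else u : Function.End X)
      (w (r ω x₀))) ∈ dynCubes G X (d + 1) :=
    apply_mem_dynCubes (offTop_mem_cubeEllis (hLE hu) huu)
      (apply_mem_dynCubes (const_mem_cubeEllis (hLE hw))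
        (apply_mem_dynCubes hr (const_mem_dynCubes x₀)))
  refine ⟨x₀, w (r top x₀), ?_, hx₀, ?_⟩
  · convert hmem using 1
    funext ω
    by_cases hω : ω = fun _ => true
    · rw [lowerCorner, if_pos hω, if_pos hω, hω]
      rfl
    · have hex : ∃ i ∈ Finset.univ, ω i = false := by
        by_contra! h
        exact hω (funext fun i => by simpa using h i (Finset.mem_univ i))
      rw [lowerCorner, if_neg hω, if_neg hω, hru ω hex, hux']
      exact ((congrFun (hLid w hw hww u hu) x₀).trans hux').symm
  · rw [hpres w (hLE hw) hrt, ← htop]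
    exact congrArg π ((congrFun (hLid u hu huu w hw) (c top)).trans hwx)

/-! ### Cubes under factor maps -/

theorem map_dynCubes {Y : Type*} [TopologicalSpace Y] [MulAction G Y]
    {π : X → Y} (hπ : Continuous π) (hG : ∀ (g : G) (x : X), π (g • x) = g • π x)
    {d : ℕ} {c : Cube d → X} (hc : c ∈ dynCubes G X d) :
    (fun ω => π (c ω)) ∈ dynCubes G Y d := by
  refine map_mem_closure (f := fun (c : Cube d → X) ω => π (c ω))
    (continuous_pi fun ω => hπ.comp (continuous_apply ω)) hc ?_
  rintro _ ⟨γ, hγ, x, rfl⟩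
  exact ⟨γ, hγ, π x, funext fun ω => hG _ _⟩

theorem exists_lift_dynCubes [CompactSpace X] {Y : Type*} [TopologicalSpace Y] [T2Space Y]
    [MulAction G Y] {π : X → Y} (hπ : Continuous π)
    (hG : ∀ (g : G) (x : X), π (g • x) = g • π x) (hsurj : Function.Surjective π)
    {d : ℕ} {b : Cube d → Y} (hb : b ∈ dynCubes G Y d) :
    ∃ c ∈ dynCubes G X d, ∀ ω, π (c ω) = b ω := by
  have hf : Continuous fun (c : Cube d → X) ω => π (c ω) :=
    continuous_pi fun ω => hπ.comp (continuous_apply ω)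
  have hmem : b ∈ (fun (c : Cube d → X) ω => π (c ω)) '' dynCubes G X d := by
    refine closure_minimal ?_ (isClosed_closure.isCompact.image hf).isClosed hb
    rintro _ ⟨γ, hγ, y, rfl⟩
    obtain ⟨x, rfl⟩ := hsurj y
    exact ⟨_, subset_closure ⟨γ, hγ, x, rfl⟩, funext fun ω => hG _ _⟩
  obtain ⟨c, hc, rfl⟩ := hmem
  exact ⟨c, hc, fun _ => rfl⟩

end Ellis

end NilRP

theorem mainTheorem2 {G X Y : Type*}
    [Group G] [TopologicalSpace G] [IsTopologicalGroup G] [T2Space G]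
    [TopologicalSpace X] [CompactSpace X] [T2Space X] [MulAction G X] [ContinuousSMul G X]
    [TopologicalSpace Y] [CompactSpace Y] [T2Space Y] [MulAction G Y] [ContinuousSMul G Y]
    [MulAction.IsMinimal G X]
    (π : X → Y) (hπ_cont : Continuous π) (hπ_equiv : ∀ (g : G) (x : X), π (g • x) = g • π x)
    (hπ_surj : Function.Surjective π) (d : ℕ) (hd : 1 ≤ d) :
    Prod.map π π '' NilRP.NRP G X d = NilRP.NRP G Y d := by
  ext ⟨y, z⟩
  constructor
  · rintro ⟨⟨x, x'⟩, hx, heq⟩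
    obtain ⟨rfl, rfl⟩ := Prod.mk.inj heq
    have h := NilRP.map_dynCubes hπ_cont hπ_equiv hx
    simp only [NilRP.lowerCorner, apply_ite π] at h
    exact h
  · intro h
    obtain ⟨c, hc, hcπ⟩ := NilRP.exists_lift_dynCubes hπ_cont hπ_equiv hπ_surj h
    obtain ⟨x, x', hx, rfl, rfl⟩ :=
      NilRP.exists_lowerCorner_mem_dynCubes hπ_cont hπ_equiv hc hcπ
    exact ⟨(x, x'), hx, rfl⟩
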